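/- Let $f:\mathbb{C}\to\mathbb{C}$ be a transcendental entire function, that is, an entire function which is not a polynomial. For $r\ge 0$ let $$m(r)=\min\{|f(z)| : |z|=r\}$$ be the minimum modulus of $f$, let $m^n(r)$ denote the $n$-th iterate of the function $r\mapsto m(r)$, and let $f^n$ denote the $n$-th iterate of $f$. Suppose that there exists $r>0$ such that $m^n(r)\to\infty$ as $n\to\infty$. Then the set $$I^{+}(f)=\{z\in\mathbb{C} : \text{the sequence } (f^n(z))_{n\in\mathbb{N}} \text{ is unbounded}\}$$ of points whose orbits under $f$ are unbounded is connected (and, in particular, non-empty). -/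

import Mathlib

/-- A transcendental entire function: holomorphic on all of `ℂ` and not a polynomial. -/
def IsTranscendentalEntire (f : ℂ → ℂ) : Prop :=
  Differentiable ℂ f ∧ ¬ ∃ p : Polynomial ℂ, ∀ z : ℂ, f z = p.eval z

/-- The minimum modulus `m(r) = m(r, f) = min {|f z| : |z| = r}`.
For `r ≥ 0` and continuous `f` the infimum is attained, see `minModulus_isLeast`. -/
noncomputable def minModulus (f : ℂ → ℂ) (r : ℝ) : ℝ :=
  sInf ((fun z : ℂ => ‖f z‖) '' Metric.sphere (0 : ℂ) r)

/-- `minModulus f r` is a genuine minimum over the circle `|z| = r`. -/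
theorem minModulus_isLeast (f : ℂ → ℂ) (hf : Continuous f) (r : ℝ) (hr : 0 ≤ r) :
    IsLeast ((fun z : ℂ => ‖f z‖) '' Metric.sphere (0 : ℂ) r) (minModulus f r) :=
  ((isCompact_sphere (0 : ℂ) r).image hf.norm).isLeast_sInf
    ((NormedSpace.sphere_nonempty.mpr hr).image _)

/-- The set `I⁺(f)` of points whose orbit under `f` is unbounded. -/
def unboundedOrbitSet (f : ℂ → ℂ) : Set ℂ :=
  {z : ℂ | ¬ Bornology.IsBounded (Set.range fun n : ℕ => f^[n] z)}

/-! Tail minima of `m^n(r)` give radii `t n → ∞` such that `f` sends the circle of radius `t n`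
outside the disc of radius `t (n + 1)`. If a connected set meets the disc of radius `t K` at every
time but leaves it once, its images cross all larger circles in turn. Hence a continuum of bounded
orbits is uniformly bounded, by any `t K` that bounds the orbit of one of its points
(`IsExpandingRadii.subset_orbitBoundedBy`).

If `I⁺(f)` were disconnected, a closed set `F` of bounded orbits would separate two of its points
`u`, `v`. By the uniform bound, components of `F` in large discs are compact and stay off the
boundary circle; by the maximum principle, `u` and `v` lie in no hole of them. So `(z - u) / (z -
v)` has a continuous logarithm near each one, and these patch to a logarithm on `F` and near
infinity. A winding number argument (`not_hasLogOn_of_separates`) excludes this. -/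

open Set Filter Topology

/-! ### Components of compact sets and boundary bumping -/

/-- In a compact set, a point can be cut off inside any open neighbourhood of its component. -/
theorem exists_isCompact_subset_of_connectedComponentIn_subset {X : Type*} [TopologicalSpace X]
    [T2Space X] {M N : Set X} (hM : IsCompact M) {x : X} (hx : x ∈ M) (hN : IsOpen N)
    (h : connectedComponentIn M x ⊆ N) :
    ∃ Z ⊆ M, x ∈ Z ∧ Z ⊆ N ∧ IsCompact Z ∧ IsCompact (M \ Z) := by
  have : CompactSpace M := isCompact_iff_compactSpace.mp hM
  rw [connectedComponentIn_eq_image hx, connectedComponent_eq_iInter_isClopen] at h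
  have : Nonempty {s : Set M // IsClopen s ∧ (⟨x, hx⟩ : M) ∈ s} :=
    ⟨⟨univ, isClopen_univ, mem_univ _⟩⟩
  obtain ⟨⟨s, hs, hxs⟩, hsN⟩ := exists_subset_nhds_of_isCompact
    (V := fun s : {s : Set M // IsClopen s ∧ (⟨x, hx⟩ : M) ∈ s} => (s : Set M))
    (U := (↑) ⁻¹' N)
    (fun s t => ⟨⟨s ∩ t, s.2.1.inter t.2.1, s.2.2, t.2.2⟩, inter_subset_left, inter_subset_right⟩)
    (fun s => s.2.1.isClosed.isCompact)
    (fun y hy => (hN.preimage continuous_subtype_val).mem_nhds (h ⟨y, hy, rfl⟩))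
  refine ⟨(↑) '' s, ?_, ⟨_, hxs, rfl⟩, ?_, hs.isClosed.isCompact.image continuous_subtype_val, ?_⟩
  · rintro _ ⟨y, -, rfl⟩
    exact y.2
  · rintro _ ⟨y, hy, rfl⟩
    exact hsN hy
  · convert hs.compl.isClosed.isCompact.image continuous_subtype_val using 1
    ext y
    simp only [Set.mem_sdiff, mem_image, Subtype.exists, mem_compl_iff]
    grind

/-- Boundary bumping: in a continuum `E`, the component of `{c ≤ φ}` through a point is all of `E`
or reaches the level `c`. -/
theorem exists_le_of_connectedComponentIn_superlevel {X : Type*} [TopologicalSpace X] [T2Space X]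
    {E : Set X} (hE : IsCompact E) (hE' : IsPreconnected E) {φ : X → ℝ} (hφ : Continuous φ)
    {c : ℝ} {x : X} (hx : x ∈ E) (hxc : c ≤ φ x) (hne : ∃ y ∈ E, φ y < c) :
    ∃ y ∈ connectedComponentIn (E ∩ {y | c ≤ φ y}) x, φ y ≤ c := by
  by_contra! H
  obtain ⟨Z, hZM, hxZ, hZN, hZ, hZ'⟩ := exists_isCompact_subset_of_connectedComponentIn_subset
    (hE.inter_right (isClosed_le continuous_const hφ)) (x := x) ⟨hx, hxc⟩
    (isOpen_lt continuous_const hφ) H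
  -- `φ > c` on `Z`, so `Z` and this closed set are disjoint and cover `E`.
  have hcl : IsClosed (((E ∩ {y | c ≤ φ y}) \ Z) ∪ (E ∩ {y | φ y ≤ c})) :=
    hZ'.isClosed.union (hE.isClosed.inter (isClosed_le hφ continuous_const))
  obtain ⟨y, hy, hyc⟩ := hne
  obtain ⟨w, -, hw, hw'⟩ := isPreconnected_closed_iff.mp hE' Z _ hZ.isClosed hcl
    (fun w hw => by
      by_cases h1 : w ∈ Z
      · exact Or.inl h1
      · rcases le_total c (φ w) with h | h
        · exact Or.inr (Or.inl ⟨⟨hw, h⟩, h1⟩)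
        · exact Or.inr (Or.inr ⟨hw, h⟩))
    ⟨x, hx, hxZ⟩ ⟨y, hy, Or.inr ⟨hy, hyc.le⟩⟩
  rcases hw' with h | h
  · exact h.2 hw
  · exact lt_irrefl c (lt_of_lt_of_le (hZN hw) h.2)

theorem isCompact_connectedComponentIn {X : Type*} [TopologicalSpace X] [T2Space X]
    {M : Set X} (hM : IsCompact M) (x : X) : IsCompact (connectedComponentIn M x) := by
  by_cases hx : x ∈ M
  · have : CompactSpace M := isCompact_iff_compactSpace.mp hM
    rw [connectedComponentIn_eq_image hx]
    exact isClosed_connectedComponent.isCompact.image continuous_subtype_val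
  · rw [connectedComponentIn_eq_empty hx]
    exact isCompact_empty

/-! ### Continuous logarithms and holes of compact sets -/

/-- `z - a` has a continuous logarithm on a neighbourhood of `s`. -/
def HasLogNear (s : Set ℂ) (a : ℂ) : Prop :=
  ∃ N, IsOpen N ∧ s ⊆ N ∧ ∃ l : ℂ → ℂ, ContinuousOn l N ∧ ∀ z ∈ N, Complex.exp (l z) = z - a

theorem Complex.one_sub_mem_slitPlane {w : ℂ} (hw : ‖w‖ < 1) : 1 - w ∈ Complex.slitPlane := by
  rw [sub_eq_add_neg]
  exact Complex.mem_slitPlane_of_norm_lt_one (by rwa [norm_neg])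

theorem hasLogNear_of_norm_lt {s : Set ℂ} {a : ℂ} (h : ∀ z ∈ s, ‖z‖ < ‖a‖) : HasLogNear s a := by
  by_cases ha : a = 0
  · refine ⟨∅, isOpen_empty, fun z hz => ?_, 0, continuousOn_empty _, by simp⟩
    have := h z hz
    rw [ha, norm_zero] at this
    exact absurd this (not_lt.mpr (norm_nonneg _))
  have hsl : ∀ z ∈ {z : ℂ | ‖z‖ < ‖a‖}, 1 - z / a ∈ Complex.slitPlane := fun z hz =>
    Complex.one_sub_mem_slitPlane (by
      rw [norm_div, div_lt_one (norm_pos_iff.mpr ha)]; exact hz)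
  refine ⟨{z | ‖z‖ < ‖a‖}, isOpen_lt continuous_norm continuous_const, h,
    fun z => Complex.log (-a) + Complex.log (1 - z / a), ?_, fun z hz => ?_⟩
  · exact continuousOn_const.add (ContinuousOn.clog (by fun_prop) hsl)
  · rw [Complex.exp_add, Complex.exp_log (neg_ne_zero.mpr ha),
      Complex.exp_log (Complex.slitPlane_ne_zero (hsl z hz))]
    field_simp
    ring

/-- Factor `z - b = (z - a) (1 - (b - a) / (z - a))`; the second factor lies in the slit plane. -/
theorem HasLogNear.of_norm_sub_lt {s : Set ℂ} {a b : ℂ} (ha : HasLogNear s a)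
    (h : ∀ z ∈ s, ‖b - a‖ < ‖z - a‖) : HasLogNear s b := by
  obtain ⟨N, hN, hsN, l, hl, hle⟩ := ha
  have hne : ∀ z ∈ N ∩ {z : ℂ | ‖b - a‖ < ‖z - a‖}, z - a ≠ 0 := fun z hz =>
    norm_pos_iff.mp ((norm_nonneg _).trans_lt hz.2)
  have hsl : ∀ z ∈ N ∩ {z : ℂ | ‖b - a‖ < ‖z - a‖}, 1 - (b - a) / (z - a) ∈ Complex.slitPlane :=
    fun z hz => Complex.one_sub_mem_slitPlane (by
      rw [norm_div, div_lt_one (norm_pos_iff.mpr (hne z hz))]; exact hz.2)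
  refine ⟨N ∩ {z | ‖b - a‖ < ‖z - a‖}, hN.inter (isOpen_lt continuous_const (by fun_prop)),
    fun z hz => ⟨hsN hz, h z hz⟩, fun z => l z + Complex.log (1 - (b - a) / (z - a)), ?_,
    fun z hz => ?_⟩
  · refine (hl.mono inter_subset_left).add (ContinuousOn.clog ?_ hsl)
    exact continuousOn_const.sub (continuousOn_const.div (by fun_prop) hne)
  · rw [Complex.exp_add, hle z hz.1, Complex.exp_log (Complex.slitPlane_ne_zero (hsl z hz))]
    have := hne z hz
    field_simp
    ring

/-- If `z - u` has no continuous logarithm near a compact set `s`, then `u` lies in a hole of `s`. -/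
theorem exists_isBounded_frontier_subset {s : Set ℂ} (hs : IsCompact s) {u : ℂ} (hu : u ∉ s)
    (h : ¬ HasLogNear s u) :
    ∃ B : Set ℂ, Bornology.IsBounded B ∧ u ∈ B ∧ frontier B ⊆ s := by
  have key : ∀ a ∉ s, ∃ d > 0, ∀ z ∈ s, d ≤ ‖z - a‖ := fun a ha => by
    obtain ⟨d, hd, hd'⟩ := Metric.isOpen_iff.mp hs.isClosed.isOpen_compl a ha
    refine ⟨d, hd, fun z hz => ?_⟩
    by_contra! hlt
    exact hd' (mem_ball_iff_norm.mpr hlt) hz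
  have hA : IsOpen {a | a ∉ s ∧ HasLogNear s a} := Metric.isOpen_iff.mpr fun a ha => by
    obtain ⟨d, hd, hd'⟩ := key a ha.1
    refine ⟨d, hd, fun b hb => ⟨fun hbs => ?_, ha.2.of_norm_sub_lt fun z hz => ?_⟩⟩
    · exact absurd (mem_ball_iff_norm.mp hb) (not_lt.mpr (hd' b hbs))
    · exact (mem_ball_iff_norm.mp hb).trans_le (hd' z hz)
  have hB : IsOpen {a | a ∉ s ∧ ¬ HasLogNear s a} := Metric.isOpen_iff.mpr fun b hb => by
    obtain ⟨d, hd, hd'⟩ := key b hb.1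
    -- Here the logarithm passes from `a` back to `b`, so the distance from `a` to `s` must exceed
    -- `‖b - a‖`: it is at least `d - ‖b - a‖`, which halving makes large enough.
    refine ⟨d / 2, half_pos hd, fun a ha => ?_⟩
    have hab := mem_ball_iff_norm.mp ha
    refine ⟨fun has => ?_, fun hla => hb.2 (hla.of_norm_sub_lt fun z hz => ?_)⟩
    · linarith [hd' a has]
    · have h1 := hd' z hz
      have h2 := norm_sub_le_norm_sub_add_norm_sub z a b
      rw [norm_sub_rev b a]
      linarith
  refine ⟨{a | a ∉ s ∧ ¬ HasLogNear s a}, ?_, ⟨hu, h⟩, fun x hx => ?_⟩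
  · obtain ⟨R, hR⟩ := hs.isBounded.exists_norm_le
    refine (isBounded_iff_forall_norm_le).mpr ⟨R, fun a ha => ?_⟩
    by_contra! hlt
    exact ha.2 (hasLogNear_of_norm_lt fun z hz => (hR z hz).trans_lt hlt)
  · rw [hB.frontier_eq] at hx
    by_contra hxs
    have hxA : x ∈ {a | a ∉ s ∧ HasLogNear s a} :=
      ⟨hxs, by_contra fun hn => hx.2 ⟨hxs, hn⟩⟩
    obtain ⟨y, hyA, hyB⟩ := mem_closure_iff.mp hx.1 _ hA hxA
    exact hyB.2 hyA.2

/-! ### Winding numbers and separation of the plane -/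

/-- A nowhere vanishing continuous function on the plane has winding number zero at infinity. -/
theorem not_forall_eq_sub_of_continuous {q : ℂ → ℂ} (hq : Continuous q) (hq0 : ∀ z, q z ≠ 0)
    (u : ℂ) (R : ℝ) : ¬ ∀ z, R ≤ ‖z‖ → q z = z - u := by
  intro H
  obtain ⟨l, ⟨-, hl⟩, -⟩ := Complex.isCoveringMap_exp.existsUnique_continuousMap_lifts
    (⟨fun z => ⟨q z, hq0 z⟩, by fun_prop⟩ : C(ℂ, {z : ℂ // z ≠ 0})) 0 (Complex.log (q 0))
    (Subtype.ext (Complex.exp_log (hq0 0)))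
  have hl' : ∀ z, Complex.exp (l z) = q z := fun z => congrArg Subtype.val (congrFun hl z)
  set ρ : ℝ := max R 0 + ‖u‖ + 1 with hρdef
  have hρR : R ≤ ρ := by linarith [le_max_left R 0, norm_nonneg u]
  have hρu : ‖u‖ < ρ := by linarith [le_max_right R 0]
  have hρ0 : 0 < ρ := (norm_nonneg u).trans_lt hρu
  have hρC : (ρ : ℂ) ≠ 0 := by exact_mod_cast hρ0.ne'
  set e : ℝ → ℂ := fun θ => ρ * Complex.exp (θ * Complex.I) with he
  have hen : ∀ θ, ‖e θ‖ = ρ := fun θ => by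
    simp [he, Complex.norm_exp_ofReal_mul_I, abs_of_pos hρ0]
  have hec : Continuous e := by fun_prop
  have he0 : ∀ θ, e θ ≠ 0 := fun θ => norm_pos_iff.mp (by rw [hen]; exact hρ0)
  have hsl : ∀ θ, 1 - u / e θ ∈ Complex.slitPlane := fun θ =>
    Complex.one_sub_mem_slitPlane (by rw [norm_div, hen, div_lt_one hρ0]; exact hρu)
  -- On the circle, `q = ρ e^{iθ} (1 - u / e θ)`, so `exp ∘ k` is the constant `ρ` and `k` is
  -- constant. Comparing `θ = 0` with `θ = 2π` gives `2πi = 0`.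
  set k : ℝ → ℂ := fun θ => l (e θ) - θ * Complex.I - Complex.log (1 - u / e θ) with hk
  have hkc : Continuous k :=
    ((l.continuous.comp hec).sub (by fun_prop)).sub
      (Continuous.clog (continuous_const.sub (continuous_const.div hec he0)) hsl)
  have hke : ∀ θ, Complex.exp (k θ) = ρ := fun θ => by
    have h1 := Complex.slitPlane_ne_zero (hsl θ)
    have h2 := he0 θ
    rw [hk, Complex.exp_sub, Complex.exp_sub, hl', H _ (by rw [hen]; exact hρR),
      Complex.exp_log h1, div_div, div_eq_iff (mul_ne_zero (Complex.exp_ne_zero _) h1)]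
    rw [show (ρ : ℂ) * (Complex.exp (θ * Complex.I) * (1 - u / e θ)) = e θ * (1 - u / e θ) by
      simp only [he]; ring]
    field_simp
  have hconst : k = fun _ => k 0 := Complex.isCoveringMap_exp.eq_of_comp_eq hkc continuous_const
    (funext fun θ => Subtype.ext ((hke θ).trans (hke 0).symm)) 0 rfl
  have h2 := congrFun hconst (2 * Real.pi)
  have he2 : e (2 * Real.pi) = e 0 := by
    simp [he, Complex.exp_two_pi_mul_I]
  simp only [hk, he2] at h2
  have : ((2 * Real.pi : ℝ) : ℂ) * Complex.I = 0 := by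
    push_cast at h2 ⊢
    linear_combination -h2
  simp [Real.pi_ne_zero] at this

/-- `g` has a continuous logarithm on `s`. -/
def HasLogOn (s : Set ℂ) (g : ℂ → ℂ) : Prop :=
  ∃ l : ℂ → ℂ, ContinuousOn l s ∧ ∀ z ∈ s, Complex.exp (l z) = g z

theorem HasLogOn.union {s t : Set ℂ} {g : ℂ → ℂ} (hs : HasLogOn s g) (ht : HasLogOn t g)
    (hsc : IsClosed s) (htc : IsClosed t) (hd : Disjoint s t) : HasLogOn (s ∪ t) g := by
  classical
  obtain ⟨l, hl, hle⟩ := hs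
  obtain ⟨m, hm, hme⟩ := ht
  have h1 : ∀ z ∈ s, s.piecewise l m z = l z := fun z hz => piecewise_eq_of_mem _ _ _ hz
  have h2 : ∀ z ∈ t, s.piecewise l m z = m z := fun z hz =>
    piecewise_eq_of_notMem _ _ _ (disjoint_right.mp hd hz)
  refine ⟨s.piecewise l m, (hl.congr h1).union_of_isClosed (hm.congr h2) hsc htc, ?_⟩
  rintro z (hz | hz)
  · rw [h1 z hz, hle z hz]
  · rw [h2 z hz, hme z hz]

theorem HasLogOn.mono {s t : Set ℂ} {g : ℂ → ℂ} (ht : HasLogOn t g) (h : s ⊆ t) :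
    HasLogOn s g :=
  let ⟨l, hl, hle⟩ := ht
  ⟨l, hl.mono h, fun z hz => hle z (h hz)⟩

/-- If disjoint open sets `U ∋ u` and `V ∋ v` are separated by a closed set `F`, then
`(z - u) / (z - v)` has no continuous logarithm on `F` together with a neighbourhood of infinity. -/
theorem not_hasLogOn_of_separates {U V : Set ℂ} (hU : IsOpen U) (hV : IsOpen V)
    (hUV : Disjoint U V) {u v : ℂ} (hu : u ∈ U) (hv : v ∈ V) (R : ℝ) :
    ¬ HasLogOn ((U ∪ V)ᶜ ∪ {z | R ≤ ‖z‖}) (fun z => (z - u) / (z - v)) := by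
  classical
  rintro ⟨l, hl, hle⟩
  have hcl : IsClosed ((U ∪ V)ᶜ ∪ {z : ℂ | R ≤ ‖z‖}) :=
    (hU.union hV).isClosed_compl.union (isClosed_le continuous_const continuous_norm)
  -- Tietze extension of the logarithm to the whole plane.
  obtain ⟨L, hL⟩ := ContinuousMap.exists_restrict_eq hcl ⟨_, hl.domRestrict⟩
  have hLe : ∀ z ∈ (U ∪ V)ᶜ ∪ {z : ℂ | R ≤ ‖z‖},
      Complex.exp (L z) = (z - u) / (z - v) := fun z hz => by
    have : L z = l z := DFunLike.congr_fun hL ⟨z, hz⟩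
    rw [this, hle z hz]
  have hv' : ∀ z ∈ U, z - v ≠ 0 := fun z hz h =>
    disjoint_left.mp hUV (sub_eq_zero.mp h ▸ hz) hv
  have hagree : ∀ z ∈ (U ∪ V)ᶜ ∪ {z : ℂ | R ≤ ‖z‖}, z ≠ v →
      (z - v) * Complex.exp (L z) = z - u := fun z hz hzv => by
    rw [hLe z hz, mul_div_cancel₀ _ (sub_ne_zero.mpr hzv)]
  -- The two formulas agree on `frontier U`, which misses both `U` and `V`. Neither vanishes where
  -- it is used, since `v ∉ U` and `u ∈ U`.
  refine not_forall_eq_sub_of_continuous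
    (q := fun z => if z ∈ U then (z - v) * Complex.exp (L z) else z - u) ?_ ?_ u R ?_
  · refine Continuous.if (fun z hz => hagree z (Or.inl ?_) ?_) (by fun_prop) (by fun_prop)
    · have hz' : z ∈ frontier U := hz
      rw [hU.frontier_eq] at hz'
      rintro (h | h)
      · exact hz'.2 h
      · exact disjoint_left.mp (hUV.closure_left hV) hz'.1 h
    · rintro rfl
      have hz' : z ∈ frontier U := hz
      exact disjoint_left.mp (hUV.closure_left hV) (frontier_subset_closure hz') hv
  · intro z
    split_ifs with hz
    · exact mul_ne_zero (hv' z hz) (Complex.exp_ne_zero _)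
    · exact sub_ne_zero.mpr fun h => hz (h ▸ hu)
  · intro z hz
    split_ifs with hzU
    · exact hagree z (Or.inr hz) fun h => disjoint_left.mp hUV hzU (h ▸ hv)
    · rfl

/-- The winding of numerator and denominator at infinity cancels: divide both by `z`. -/
theorem hasLogOn_div_of_norm_lt (u v : ℂ) :
    HasLogOn {z | ‖u‖ < ‖z‖ ∧ ‖v‖ < ‖z‖} (fun z => (z - u) / (z - v)) := by
  have hne : ∀ {a z : ℂ}, ‖a‖ < ‖z‖ → z ≠ 0 := fun h =>
    norm_pos_iff.mp ((norm_nonneg _).trans_lt h)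
  have hsl : ∀ {a z : ℂ}, ‖a‖ < ‖z‖ → 1 - a / z ∈ Complex.slitPlane := fun h =>
    Complex.one_sub_mem_slitPlane (by
      rw [norm_div, div_lt_one (norm_pos_iff.mpr (hne h))]; exact h)
  refine ⟨fun z => Complex.log (1 - u / z) - Complex.log (1 - v / z), ?_, fun z hz => ?_⟩
  · refine ContinuousOn.sub (ContinuousOn.clog ?_ fun z hz => hsl hz.1)
      (ContinuousOn.clog ?_ fun z hz => hsl hz.2)
    · exact continuousOn_const.sub (continuousOn_const.div continuousOn_id fun z hz => hne hz.1)
    · exact continuousOn_const.sub (continuousOn_const.div continuousOn_id fun z hz => hne hz.1)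
  · have h1 := Complex.slitPlane_ne_zero (hsl hz.1)
    have h2 := Complex.slitPlane_ne_zero (hsl hz.2)
    have h0 := hne hz.1
    rw [Complex.exp_sub, Complex.exp_log h1, Complex.exp_log h2, one_sub_div h0, one_sub_div h0,
      div_div_div_cancel_right₀ h0]

/-- Two disjoint nonempty open sets of the plane cannot be separated by a closed set which splits
into compact pieces none of which separates `u` from `v`, in the sense that
`(z - u) / (z - v)` has a continuous logarithm on each piece. -/
theorem exists_not_hasLogOn_of_separates {U V : Set ℂ} (hU : IsOpen U) (hV : IsOpen V)
    (hUV : Disjoint U V) {u v : ℂ} (hu : u ∈ U) (hv : v ∈ V)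
    (h : ∀ z ∈ (U ∪ V)ᶜ, ∃ Z ⊆ (U ∪ V)ᶜ, z ∈ Z ∧ IsCompact Z ∧ IsClosed ((U ∪ V)ᶜ \ Z) ∧
      HasLogOn Z (fun z => (z - u) / (z - v))) : False := by
  have hF : IsClosed (U ∪ V)ᶜ := (hU.union hV).isClosed_compl
  set F := (U ∪ V)ᶜ
  set r := max ‖u‖ ‖v‖
  obtain ⟨Z, hZF, hrZ, hZ, hFZ, hlog⟩ : ∃ Z ⊆ F, F ∩ Metric.closedBall 0 r ⊆ Z ∧ IsCompact Z ∧
      IsClosed (F \ Z) ∧ HasLogOn Z (fun z => (z - u) / (z - v)) := by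
    -- Finitely many pieces cover the part of `F` in the disc of radius `r`; beyond it the explicit
    -- logarithm near infinity applies.
    refine ((isCompact_closedBall (0 : ℂ) r).inter_left hF).induction_on
      (p := fun s => ∃ Z ⊆ F, s ⊆ Z ∧ IsCompact Z ∧
        IsClosed (F \ Z) ∧ HasLogOn Z (fun z => (z - u) / (z - v))) ?_ ?_ ?_ ?_
    · exact ⟨∅, empty_subset _, subset_rfl, isCompact_empty, by simpa using hF,
        0, continuousOn_empty _, by simp⟩
    · rintro s t hst ⟨Z, h1, h2, h3⟩
      exact ⟨Z, h1, hst.trans h2, h3⟩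
    · rintro s t ⟨Z, hZF, hsZ, hZ, hFZ, hl⟩ ⟨Z', hZF', hsZ', hZ', hFZ', hl'⟩
      have hdiff : Z' \ Z = Z' ∩ (F \ Z) := by
        ext z
        exact ⟨fun hz => ⟨hz.1, hZF' hz.1, hz.2⟩, fun hz => ⟨hz.1, hz.2.2⟩⟩
      have hcl : IsClosed (Z' \ Z) := hdiff ▸ hZ'.isClosed.inter hFZ
      refine ⟨Z ∪ Z', union_subset hZF hZF', union_subset_union hsZ hsZ', hZ.union hZ', ?_, ?_⟩
      · rw [← sdiff_inter_sdiff]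
        exact hFZ.inter hFZ'
      · rw [← union_sdiff_self]
        exact hl.union (hl'.mono sdiff_subset) hZ.isClosed hcl disjoint_sdiff_right
    · rintro x ⟨hxF, -⟩
      obtain ⟨Z, hZF, hxZ, hZ, hFZ, hl⟩ := h x hxF
      refine ⟨(F ∩ Metric.closedBall 0 r) ∩ (F \ Z)ᶜ,
        inter_mem self_mem_nhdsWithin (mem_nhdsWithin_of_mem_nhds
          (hFZ.isOpen_compl.mem_nhds fun hx => hx.2 hxZ)),
        Z, hZF, fun y hy => ?_, hZ, hFZ, hl⟩
      by_contra hyZ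
      exact hy.2 ⟨hy.1.1, hyZ⟩
  obtain ⟨R, hR⟩ := hZ.isBounded.exists_norm_le
  have hfar : HasLogOn ((F \ Z) ∪ {z | max R r + 1 ≤ ‖z‖}) (fun z => (z - u) / (z - v)) := by
    refine (hasLogOn_div_of_norm_lt u v).mono fun z hz => max_lt_iff.mp ?_
    rcases hz with hz | hz
    · by_contra! hle
      exact hz.2 (hrZ ⟨hz.1, mem_closedBall_zero_iff.mpr hle⟩)
    · have : max R r + 1 ≤ ‖z‖ := hz
      linarith [le_max_right R r]
  refine not_hasLogOn_of_separates hU hV hUV hu hv (max R r + 1)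
    ((hlog.union hfar hZ.isClosed (hFZ.union (isClosed_le continuous_const continuous_norm))
      ?_).mono ?_)
  · refine disjoint_left.mpr fun z hz hz' => ?_
    rcases hz' with hz' | hz'
    · exact hz'.2 hz
    · have : max R r + 1 ≤ ‖z‖ := hz'
      linarith [le_max_left R r, hR z hz]
  · rintro z (hz | hz)
    · by_cases hzZ : z ∈ Z
      · exact Or.inl hzZ
      · exact Or.inr (Or.inl ⟨hz, hzZ⟩)
    · exact Or.inr (Or.inr hz)

/-! ### Expanding radii and continua of bounded orbits -/

/-- The points whose whole orbit stays in the closed disc of radius `R`. -/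
def orbitBoundedBy (f : ℂ → ℂ) (R : ℝ) : Set ℂ :=
  {z | ∀ k, ‖f^[k] z‖ ≤ R}

theorem isClosed_orbitBoundedBy {f : ℂ → ℂ} (hf : Continuous f) (R : ℝ) :
    IsClosed (orbitBoundedBy f R) := by
  rw [orbitBoundedBy, ofPred_forall]
  exact isClosed_iInter fun k => isClosed_le (hf.iterate k).norm continuous_const

/-- An increasing sequence of radii `t n → ∞` such that `f` maps the circle of radius `t n`
outside the disc of radius `t (n + 1)`. -/
structure IsExpandingRadii (f : ℂ → ℂ) (t : ℕ → ℝ) : Prop where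
  monotone : Monotone t
  tendsto : Tendsto t atTop atTop
  le_norm : ∀ n z, ‖z‖ = t n → t (n + 1) ≤ ‖f z‖

/-- The running minima from the right of the iterated minimum modulus are expanding radii. -/
theorem exists_isExpandingRadii {f : ℂ → ℂ} {r : ℝ}
    (h : Tendsto (fun n : ℕ => (minModulus f)^[n] r) atTop atTop) :
    ∃ t, IsExpandingRadii f t := by
  have hmin : ∀ N : ℕ, ∃ j, ∀ i, (minModulus f)^[N + j] r ≤ (minModulus f)^[N + i] r := fun N => by
    have h' : Tendsto (fun i : ℕ => (minModulus f)^[N + i] r) cofinite atTop := by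
      rw [Nat.cofinite_eq_atTop]
      exact h.comp (tendsto_atTop_mono (fun i => Nat.le_add_left i N) tendsto_id)
    exact h'.exists_forall_le
  choose j hj using hmin
  have hj' : ∀ N i, N ≤ i → (minModulus f)^[N + j N] r ≤ (minModulus f)^[i] r := fun N i hi => by
    have := hj N (i - N)
    rwa [Nat.add_sub_cancel' hi] at this
  -- The tail minimum is attained at index `N + j N`, whose successor belongs to the tail from `N +
  -- 1`; this gives `t (N + 1) ≤ m (t N)`.
  refine ⟨fun N => (minModulus f)^[N + j N] r, fun N M hNM => hj' N _ (by omega), ?_,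
    fun N z hz => (hj' (N + 1) (N + j N + 1) (by omega)).trans ?_⟩
  · exact h.comp (tendsto_atTop_mono (fun N => Nat.le_add_right N (j N)) tendsto_id)
  · rw [Function.iterate_succ_apply']
    refine csInf_le ⟨0, ?_⟩ ⟨z, mem_sphere_zero_iff_norm.mpr hz, rfl⟩
    rintro _ ⟨w, -, rfl⟩
    exact norm_nonneg _

namespace IsExpandingRadii

variable {f : ℂ → ℂ} {t : ℕ → ℝ}

theorem notMem_unboundedOrbitSet_iff (ht : IsExpandingRadii f t) {z : ℂ} :
    z ∉ unboundedOrbitSet f ↔ ∃ K, z ∈ orbitBoundedBy f (t K) := by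
  rw [unboundedOrbitSet, mem_ofPred_eq, not_not]
  refine ⟨fun h => ?_, fun ⟨K, hK⟩ => ?_⟩
  · obtain ⟨R, hR⟩ := h.exists_norm_le
    obtain ⟨K, hK⟩ := (ht.tendsto.eventually_ge_atTop R).exists
    exact ⟨K, fun k => (hR _ ⟨k, rfl⟩).trans hK⟩
  · refine isBounded_iff_forall_norm_le.mpr ⟨t K, ?_⟩
    rintro _ ⟨k, rfl⟩
    exact hK k

/-- A connected set which keeps returning to the disc of radius `t K` but leaves it once is
stretched across all the larger circles. -/
theorem exists_le_norm_iterate (ht : IsExpandingRadii f t) (hf : Continuous f) {E : Set ℂ}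
    (hE : IsPreconnected E) {K : ℕ} (hlow : ∀ k, ∃ z ∈ E, ‖f^[k] z‖ ≤ t K) {k : ℕ}
    (hk : ∃ z ∈ E, t K ≤ ‖f^[k] z‖) (j : ℕ) : ∃ z ∈ E, t (K + j) ≤ ‖f^[k + j] z‖ := by
  induction j with
  | zero => exact hk
  | succ j ih =>
    obtain ⟨b, hb, hb'⟩ := ih
    obtain ⟨a, ha, ha'⟩ := hlow (k + j)
    obtain ⟨z, hz, hz'⟩ := hE.intermediate_value ha hb (hf.iterate (k + j)).norm.continuousOn
      ⟨ha'.trans (ht.monotone (Nat.le_add_right K j)), hb'⟩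
    refine ⟨z, hz, ?_⟩
    rw [← add_assoc, ← add_assoc, Function.iterate_succ_apply']
    exact ht.le_norm _ _ hz'

theorem subset_orbitBoundedBy_of_low (ht : IsExpandingRadii f t) (hf : Continuous f) {E : Set ℂ}
    (hE : IsPreconnected E) {K : ℕ} (hlow : ∀ k, ∃ z ∈ E, ‖f^[k] z‖ ≤ t K) {K' : ℕ}
    (hK' : E ⊆ orbitBoundedBy f (t K')) : E ⊆ orbitBoundedBy f (t K) := by
  intro z hz k
  by_contra! hlt
  obtain ⟨j, hj⟩ := ((tendsto_add_atTop_iff_nat K).mpr ht.tendsto |>.eventually_gt_atTop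
    (t K')).exists
  obtain ⟨w, hw, hw'⟩ := ht.exists_le_norm_iterate hf hE hlow ⟨z, hz, hlt.le⟩ j
  rw [add_comm K j] at hw'
  linarith [hK' hw (k + j)]

/-- Inductive step towards an unbounded orbit: shrink a continuum that is not uniformly bounded, so
that at some time it lies wholly beyond `t L`. If every component of `E ∩ orbitBoundedBy f (t K)`
met the disc of radius `t L` at all times, `E` would be bounded by `t L`. -/
theorem exists_subcontinuum (ht : IsExpandingRadii f t) (hf : Continuous f) {E : Set ℂ}
    (hE : IsCompact E) (hEc : IsPreconnected E) (hEI : ∀ z ∈ E, z ∉ unboundedOrbitSet f)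
    (hub : ∀ K, ¬ E ⊆ orbitBoundedBy f (t K)) (L : ℕ) :
    ∃ E' ⊆ E, IsCompact E' ∧ IsPreconnected E' ∧ (∀ K, ¬ E' ⊆ orbitBoundedBy f (t K)) ∧
      ∃ k, ∀ z ∈ E', t L < ‖f^[k] z‖ := by
  obtain ⟨z, hz, K, hzK, k, hk⟩ : ∃ z ∈ E, ∃ K, z ∈ orbitBoundedBy f (t K) ∧
      ∃ k, ∀ w ∈ connectedComponentIn (E ∩ orbitBoundedBy f (t K)) z, t L < ‖f^[k] w‖ := by
    by_contra! H
    refine hub L fun z hz => ?_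
    obtain ⟨K, hK⟩ := ht.notMem_unboundedOrbitSet_iff.mp (hEI z hz)
    exact ht.subset_orbitBoundedBy_of_low hf isPreconnected_connectedComponentIn (H z hz K hK)
      ((connectedComponentIn_subset _ _).trans inter_subset_right)
      (mem_connectedComponentIn ⟨hz, hK⟩)
  have hφ : Continuous fun w => ‖f^[k] w‖ := (hf.iterate k).norm
  have hzC := mem_connectedComponentIn (F := E ∩ orbitBoundedBy f (t K)) ⟨hz, hzK⟩
  obtain ⟨w, hw, hmin⟩ := (isCompact_connectedComponentIn
    (hE.inter_right (isClosed_orbitBoundedBy hf (t K))) z).exists_isMinOn ⟨z, hzC⟩ hφ.continuousOn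
  -- `c` is strictly below the minimum of `‖f^[k] ·‖` on the component. A uniformly bounded `E'`
  -- would be bounded by `t K`, hence contained in that component; boundary bumping makes it reach
  -- level `c`, a contradiction.
  obtain ⟨c, hLc, hcw⟩ := exists_between (hk w hw)
  have hcz : c ≤ ‖f^[k] z‖ := hcw.le.trans (hmin hzC)
  have hsub := connectedComponentIn_subset (E ∩ {y | c ≤ ‖f^[k] y‖}) z
  have hzE' := mem_connectedComponentIn (F := E ∩ {y | c ≤ ‖f^[k] y‖}) ⟨hz, hcz⟩
  refine ⟨connectedComponentIn (E ∩ {y | c ≤ ‖f^[k] y‖}) z, hsub.trans inter_subset_left,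
    isCompact_connectedComponentIn (hE.inter_right (isClosed_le continuous_const hφ)) z,
    isPreconnected_connectedComponentIn, fun K' hK' => ?_, k,
    fun y hy => hLc.trans_le (hsub hy).2⟩
  by_cases hne : ∃ y ∈ E, ‖f^[k] y‖ < c
  · obtain ⟨y, hy, hyc⟩ := exists_le_of_connectedComponentIn_superlevel hE hEc hφ hz hcz hne
    have hbd := ht.subset_orbitBoundedBy_of_low hf isPreconnected_connectedComponentIn
      (fun k => ⟨z, hzE', hzK k⟩) hK'
    have hyC := isPreconnected_connectedComponentIn.subset_connectedComponentIn hzE'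
      (subset_inter (hsub.trans inter_subset_left) hbd) hy
    exact absurd (hmin hyC) (not_le.mpr (hyc.trans_lt hcw))
  · push Not at hne
    exact hub K' ((hEc.subset_connectedComponentIn hz (subset_inter subset_rfl hne)).trans hK')

/-- A continuum of points with bounded orbits is uniformly bounded under iteration. -/
theorem exists_subset_orbitBoundedBy (ht : IsExpandingRadii f t) (hf : Continuous f) {E : Set ℂ}
    (hE : IsCompact E) (hEc : IsPreconnected E) (hEI : ∀ z ∈ E, z ∉ unboundedOrbitSet f) :
    ∃ K, E ⊆ orbitBoundedBy f (t K) := by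
  by_contra! hub
  let S := {A : Set ℂ // A ⊆ E ∧ IsCompact A ∧ IsPreconnected A ∧
    ∀ K, ¬ A ⊆ orbitBoundedBy f (t K)}
  have step : ∀ (A : S) (L : ℕ), ∃ A' : S, A'.1 ⊆ A.1 ∧ ∃ k, ∀ z ∈ A'.1, t L < ‖f^[k] z‖ :=
    fun ⟨A, hAE, hA, hAc, hAu⟩ L =>
      let ⟨A', h1, h2, h3, h4, h5⟩ :=
        ht.exists_subcontinuum hf hA hAc (fun z hz => hEI z (hAE hz)) hAu L
      ⟨⟨A', h1.trans hAE, h2, h3, h4⟩, h1, h5⟩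
  choose next hnext hfar using step
  -- At some time every point of `A (n + 1)` is beyond `t n`, so a point common to all `A n` has an
  -- unbounded orbit.
  let A : ℕ → S := fun n => Nat.rec ⟨E, subset_rfl, hE, hEc, hub⟩ (fun n B => next B n) n
  obtain ⟨z, hz⟩ := IsCompact.nonempty_iInter_of_sequence_nonempty_isCompact_isClosed
    (fun n => (A n).1) (fun n => hnext (A n) n)
    (fun n => nonempty_iff_ne_empty.mpr fun h => (A n).2.2.2.2 0 (h ▸ empty_subset _))
    (A 0).2.2.1 (fun n => (A n).2.2.1.isClosed)
  rw [mem_iInter] at hz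
  obtain ⟨K, hK⟩ := ht.notMem_unboundedOrbitSet_iff.mp (hEI z (hz 0))
  obtain ⟨k, hk⟩ := hfar (A K) K
  exact absurd (hK k) (not_le.mpr (hk z (hz (K + 1))))

theorem subset_orbitBoundedBy (ht : IsExpandingRadii f t) (hf : Continuous f) {E : Set ℂ}
    (hE : IsCompact E) (hEc : IsPreconnected E) (hEI : ∀ z ∈ E, z ∉ unboundedOrbitSet f)
    {z : ℂ} (hz : z ∈ E) {K : ℕ} (hK : z ∈ orbitBoundedBy f (t K)) :
    E ⊆ orbitBoundedBy f (t K) :=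
  let ⟨_, hK'⟩ := ht.exists_subset_orbitBoundedBy hf hE hEc hEI
  ht.subset_orbitBoundedBy_of_low hf hEc (fun k => ⟨z, hz, hK k⟩) hK'

theorem nonempty_unboundedOrbitSet (ht : IsExpandingRadii f t) (hf : Continuous f) :
    (unboundedOrbitSet f).Nonempty := by
  by_contra hne
  have hI : ∀ z, z ∉ unboundedOrbitSet f := fun z hz => hne ⟨z, hz⟩
  obtain ⟨K, hK⟩ := ht.notMem_unboundedOrbitSet_iff.mp (hI 0)
  have hK0 : 0 ≤ t K := (norm_nonneg _).trans (hK 0)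
  have hmem : ((t K + 1 : ℝ) : ℂ) ∈ Metric.closedBall (0 : ℂ) (t K + 1) := by
    rw [mem_closedBall_zero_iff, Complex.norm_real, Real.norm_of_nonneg (by linarith)]
  -- Otherwise the closed disc of radius `t K + 1` is a continuum of bounded orbits, bounded by `t
  -- K` like its centre; time `0` refutes this.
  have h := ht.subset_orbitBoundedBy hf (isCompact_closedBall (0 : ℂ) (t K + 1))
    (convex_closedBall _ _).isPreconnected (fun z _ => hI z)
    (Metric.mem_closedBall_self (by linarith)) hK hmem 0
  rw [Function.iterate_zero_apply, Complex.norm_real, Real.norm_of_nonneg (by linarith)] at h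
  linarith

end IsExpandingRadii

/-! ### Connectedness of the unbounded orbit set -/

/-- By the maximum principle, a point in a hole of a compact set of points with uniformly bounded
orbits has a bounded orbit. -/
theorem hasLogNear_of_notMem_orbitBoundedBy {f : ℂ → ℂ} (hf : Differentiable ℂ f) {s : Set ℂ}
    (hs : IsCompact s) {R : ℝ} (hsR : s ⊆ orbitBoundedBy f R) {u : ℂ}
    (hu : u ∉ orbitBoundedBy f R) : HasLogNear s u := by
  by_contra hlog
  obtain ⟨B, hB, huB, hBs⟩ := exists_isBounded_frontier_subset hs (fun h => hu (hsR h)) hlog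
  exact hu fun k => Complex.norm_le_of_forall_mem_frontier_norm_le hB
    (hf.iterate k).diffContOnCl (fun z hz => hsR (hBs hz) k) (subset_closure huB)

theorem IsExpandingRadii.isPreconnected_unboundedOrbitSet {f : ℂ → ℂ} {t : ℕ → ℝ}
    (ht : IsExpandingRadii f t) (hf : Differentiable ℂ f) :
    IsPreconnected (unboundedOrbitSet f) := by
  have hfc := hf.continuous
  rintro U₀ V₀ hU₀ hV₀ hcov ⟨u, huI, huU⟩ ⟨v, hvI, hvV⟩
  by_contra hdis
  have hsep : SeparatedNhds (unboundedOrbitSet f ∩ U₀) (unboundedOrbitSet f ∩ V₀) := by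
    -- The two pieces are separated in the plane, so complete normality gives disjoint open
    -- neighbourhoods.
    rw [separatedNhds_iff_disjoint]
    refine completely_normal (disjoint_left.mpr fun z hz hzV => ?_)
      (disjoint_left.mpr fun z hzU hz => ?_)
    · obtain ⟨y, hy, hy'⟩ := mem_closure_iff.mp hz _ hV₀ hzV.2
      exact hdis ⟨y, hy'.1, hy'.2, hy⟩
    · obtain ⟨y, hy, hy'⟩ := mem_closure_iff.mp hz _ hU₀ hzU.2
      exact hdis ⟨y, hy'.1, hy, hy'.2⟩
  obtain ⟨U, V, hU, hV, hIU, hIV, hUV⟩ := hsep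
  have hF : IsClosed (U ∪ V)ᶜ := (hU.union hV).isClosed_compl
  have hFI : ∀ z ∈ (U ∪ V)ᶜ, z ∉ unboundedOrbitSet f := fun z hz hzI => hz <|
    (hcov hzI).imp (fun h => hIU ⟨hzI, h⟩) (fun h => hIV ⟨hzI, h⟩)
  refine exists_not_hasLogOn_of_separates hU hV hUV (hIU ⟨huI, huU⟩) (hIV ⟨hvI, hvV⟩)
    fun z hz => ?_
  obtain ⟨K, hK⟩ := ht.notMem_unboundedOrbitSet_iff.mp (hFI z hz)
  -- The component of `z` stays within radius `t K`. The extra `1` lets the cut-off piece `Z` avoid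
  -- the boundary circle, so `Z` is relatively clopen in all of `(U ∪ V)ᶜ`.
  have hM : IsCompact ((U ∪ V)ᶜ ∩ Metric.closedBall 0 (t K + 1)) :=
    (isCompact_closedBall _ _).inter_left hF
  have hzM : z ∈ (U ∪ V)ᶜ ∩ Metric.closedBall 0 (t K + 1) :=
    ⟨hz, mem_closedBall_zero_iff.mpr ((hK 0).trans (by linarith))⟩
  have hCK := ht.subset_orbitBoundedBy hfc (isCompact_connectedComponentIn hM z)
    isPreconnected_connectedComponentIn
    (fun y hy => hFI y (connectedComponentIn_subset _ _ hy).1) (mem_connectedComponentIn hzM) hK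
  have hlog : ∀ a ∈ unboundedOrbitSet f, HasLogNear _ a := fun a ha =>
    hasLogNear_of_notMem_orbitBoundedBy hf (isCompact_connectedComponentIn hM z) hCK
      fun haK => ht.notMem_unboundedOrbitSet_iff.mpr ⟨K, haK⟩ ha
  obtain ⟨Nu, hNu, hCu, lu, hlu, hlue⟩ := hlog u huI
  obtain ⟨Nv, hNv, hCv, lv, hlv, hlve⟩ := hlog v hvI
  obtain ⟨Z, hZM, hzZ, hZN, hZ, hMZ⟩ := exists_isCompact_subset_of_connectedComponentIn_subset
    hM hzM ((Metric.isOpen_ball (x := (0 : ℂ)) (ε := t K + 1)).inter (hNu.inter hNv))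
    fun y hy => ⟨mem_ball_zero_iff.mpr (by linarith [show ‖y‖ ≤ t K from hCK hy 0]),
      hCu hy, hCv hy⟩
  refine ⟨Z, hZM.trans inter_subset_left, hzZ, hZ, ?_, fun y => lu y - lv y, ?_, fun y hy => ?_⟩
  · convert hMZ.isClosed.union (hF.inter (isClosed_le (continuous_const (y := t K + 1))
      continuous_norm)) using 1
    ext y
    constructor
    · rintro ⟨hy, hyZ⟩
      rcases le_total ‖y‖ (t K + 1) with h | h
      · exact Or.inl ⟨⟨hy, mem_closedBall_zero_iff.mpr h⟩, hyZ⟩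
      · exact Or.inr ⟨hy, h⟩
    · rintro (⟨hy, hyZ⟩ | ⟨hy, h⟩)
      · exact ⟨hy.1, hyZ⟩
      · exact ⟨hy, fun hyZ => absurd (mem_ball_zero_iff.mp (hZN hyZ).1) (not_lt.mpr h)⟩
  · exact (hlu.mono fun y hy => (hZN hy).2.1).sub (hlv.mono fun y hy => (hZN hy).2.2)
  · rw [Complex.exp_sub, hlue y (hZN hy).2.1, hlve y (hZN hy).2.2]

theorem theorem1p2 (f : ℂ → ℂ) (hf : IsTranscendentalEntire f)
    (hm : ∃ r : ℝ, 0 < r ∧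
      Filter.Tendsto (fun n : ℕ => (minModulus f)^[n] r) Filter.atTop Filter.atTop) :
    IsConnected (unboundedOrbitSet f) := by
  obtain ⟨r, -, hr⟩ := hm
  obtain ⟨t, ht⟩ := exists_isExpandingRadii hr
  exact ⟨ht.nonempty_unboundedOrbitSet hf.1.continuous, ht.isPreconnected_unboundedOrbitSet hf.1⟩
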